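/- **Theorem 1.1 (Galois equals monodromy).** Let $\Bbbk$ be any field and let $\pi\colon X\to Z$ be a branched cover over $\Bbbk$: $X$ and $Z$ are irreducible (reduced) varieties over $\Bbbk$, i.e. integral separated schemes of finite type over $\Bbbk$, of the same dimension, and $\pi$ is a dominant morphism over $\Bbbk$ that is separable, i.e. $\Bbbk(X)$ is a separable extension of $\Bbbk(Z)$. Let $d=[\Bbbk(X):\Bbbk(Z)]$ be the degree of $\pi$ and let $\mathbb{K}$ be the normal closure of $\Bbbk(X)/\Bbbk(Z)$. *Galois group.* There are exactly $d$ embeddings $\Bbbk(X)\to\mathbb{K}$ over $\Bbbk(Z)$. The Galois group $\mathrm{Gal}(\mathbb{K}/\Bbbk(Z))$ acts faithfully on them by composition, so each numbering of the embeddings by $1,\dots,d$ identifies it with a subgroup $\mathrm{Gal}_\pi\subset S_d$, and this subgroup is well defined up to conjugation in $S_d$. *Monodromy group.* Let $X_Z^d=X\times_Z\cdots\times_Z X$ ($d$ factors), with its map $\pi^d\colon X_Z^d\to Z$. Let $U\subset Z$ be the largest open subset over which $\pi$ is finite étale (equivalently, étale with all fibres of degree $d$). The big diagonal of $X_Z^d$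 is the union over $i\neq j$ of the closed subschemes where the $i$-th and $j$-th projections to $X$ coincide. Let $X_Z^{(d)}$ be the closure in $X_Z^d$ of the complement of the big diagonal in $(\pi^d)^{-1}(U)$. The group $S_d$ acts on $X_Z^d$ by permuting the factors, preserving $X_Z^{(d)}$. The monodromy group $\mathrm{Mon}_\pi\subset S_d$ is the subgroup that preserves an irreducible component $X'$ of $X_Z^{(d)}$; such components exist. *Conclusion.* The Galois group is equal to the monodromy group, $\mathrm{Gal}_\pi=\mathrm{Mon}_\pi$, as subgroups of $S_d$ up to conjugation: for every numbering of the embeddings and every irreducible component $X'$ of $X_Z^{(d)}$, the subgroups $\mathrm{Gal}_\pi$ and $\mathrm{Mon}_\pi$ of $S_d$ are conjugate. -/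

import Mathlib

universe u v

open AlgebraicGeometry CategoryTheory CategoryTheory.Limits

noncomputable section

namespace BranchedCover

/-! ### Field theory -/

section Field

variable (F : Type u) (E : Type v) [Field F] [Field E] [Algebra F E]

/-- Separability of a finitely generated, possibly transcendental, field extension `E / F`:
there is a separating transcendence basis, i.e. a transcendence basis `s` such that `E` is
separable algebraic over `F(s)`. -/
def IsSeparablyGenerated : Prop :=
  ∃ s : Set E, IsTranscendenceBasis F ((↑) : s → E) ∧
    Algebra.IsSeparable (IntermediateField.adjoin F s) E

/-- The normal closure of `E / F`, realized inside an algebraic closure of `E`. -/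
abbrev NormClosure : Type v := IntermediateField.normalClosure F E (AlgebraicClosure E)

/-- A numbering, by `0, …, d - 1`, of the `F`-embeddings of `E` into its normal closure. (If `α` is
a primitive element of `E / F`, this is the same as a numbering of the conjugates of `α`.) -/
abbrev Labelling (d : ℕ) : Type v := Fin d ≃ (E →ₐ[F] NormClosure F E)

variable {F E}

/-- The Galois group of the normal closure of `E / F` permutes the `F`-embeddings of `E` into the
normal closure by postcomposition; a numbering of these embeddings turns this into a homomorphism
to the symmetric group. -/
def galoisPerm {d : ℕ} (e : Labelling F E d) :
    (NormClosure F E ≃ₐ[F] NormClosure F E) →* Equiv.Perm (Fin d) where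
  toFun g :=
    { toFun := fun i => e.symm ((g : NormClosure F E →ₐ[F] NormClosure F E).comp (e i))
      invFun := fun i => e.symm ((g.symm : NormClosure F E →ₐ[F] NormClosure F E).comp (e i))
      left_inv := fun i => by
        rw [Equiv.symm_apply_eq, Equiv.apply_symm_apply]
        ext x
        simp
      right_inv := fun i => by
        rw [Equiv.symm_apply_eq, Equiv.apply_symm_apply]
        ext x
        simp }
  map_one' := by
    ext i
    simp only [Equiv.coe_fn_mk, Equiv.Perm.coe_one, id_eq]
    congr 1
    rw [Equiv.symm_apply_eq]
    ext x
    simp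
  map_mul' g h := by
    ext i
    simp only [Equiv.coe_fn_mk, Equiv.Perm.coe_mul, Function.comp_apply]
    congr 2
    rw [Equiv.apply_symm_apply]
    ext x
    simp

end Field

/-! ### Function fields -/

section FunctionField

/-- For a scheme `X` over a field `k`, the structure map `k → Γ(X, ⊤) → k(X)`. -/
def constantsMap {k : Type u} [Field k] {X : Scheme.{u}} [IsIntegral X]
    (s : X ⟶ Spec (CommRingCat.of k)) : k →+* X.functionField :=
  ((Scheme.ΓSpecIso (CommRingCat.of k)).inv ≫ s.appTop ≫
    X.presheaf.germ ⊤ (genericPoint X) trivial).hom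

/-- The dimension of an irreducible variety over `k`: the transcendence degree over `k` of its
field of rational functions. -/
def dimension {k : Type u} [Field k] {X : Scheme.{u}} [IsIntegral X]
    (s : X ⟶ Spec (CommRingCat.of k)) : Cardinal.{u} :=
  letI : Algebra k X.functionField := (constantsMap s).toAlgebra
  Algebra.trdeg k X.functionField

variable {X Z : Scheme.{u}} [IsIntegral X] [IsIntegral Z] (π : X ⟶ Z) [IsDominant π]

/-- A dominant map sends the generic point to the generic point. -/
theorem map_genericPoint : π (genericPoint X) = genericPoint Z := by
  apply IsGenericPoint.eq _ (genericPoint_spec Z)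
  have h := (genericPoint_spec X).image π.continuous
  rwa [Set.image_univ, π.denseRange.closure_range] at h

/-- Pullback of rational functions `k(Z) → k(X)` along a dominant map `π : X ⟶ Z`. -/
def functionFieldMap : Z.functionField →+* X.functionField :=
  (Z.presheaf.stalkSpecializes (specializes_of_eq (map_genericPoint π)) ≫
    π.stalkMap (genericPoint X)).hom

/-- `k(X)` as an extension of `k(Z)` by means of the dominant map `π : X ⟶ Z`. -/
abbrev functionFieldAlgebra : Algebra Z.functionField X.functionField :=
  (functionFieldMap π).toAlgebra

/-- A dominant map of integral schemes is separable if the extension of function fields is. -/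
def IsSeparableMap : Prop :=
  letI := functionFieldAlgebra π
  IsSeparablyGenerated Z.functionField X.functionField

/-- The degree of `π`, i.e. of the extension of function fields. -/
def degree : ℕ :=
  letI := functionFieldAlgebra π
  Module.finrank Z.functionField X.functionField

end FunctionField

/-! ### Fibre powers and the monodromy group -/

section Monodromy

variable {X Z : Scheme.{u}} (π : X ⟶ Z) (s : ℕ)

/-- The `s`-fold fibre product `X ×_Z ⋯ ×_Z X`. -/
abbrev fiberPower : Scheme.{u} := widePullback Z (fun _ : Fin s => X) (fun _ => π)

/-- The `i`-th projection `X ×_Z ⋯ ×_Z X ⟶ X`. -/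
abbrev fiberPowerProj (i : Fin s) : fiberPower π s ⟶ X :=
  WidePullback.π (fun _ : Fin s => π) i

/-- The structure map `X ×_Z ⋯ ×_Z X ⟶ Z`. -/
abbrev fiberPowerBase : fiberPower π s ⟶ Z := WidePullback.base (fun _ : Fin s => π)

/-- The permutation `σ` acts on `s`-tuples by moving the entry at place `i` to place `σ i`. -/
def permMap (σ : Equiv.Perm (Fin s)) : fiberPower π s ⟶ fiberPower π s :=
  WidePullback.lift (fiberPowerBase π s) (fun i => fiberPowerProj π s (σ⁻¹ i))
    (fun _ => WidePullback.π_arrow _ _)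

theorem permMap_proj (σ : Equiv.Perm (Fin s)) (i : Fin s) :
    permMap π s σ ≫ fiberPowerProj π s i = fiberPowerProj π s (σ⁻¹ i) :=
  WidePullback.lift_π _ _ _ _ _

theorem permMap_base (σ : Equiv.Perm (Fin s)) :
    permMap π s σ ≫ fiberPowerBase π s = fiberPowerBase π s :=
  WidePullback.lift_base _ _ _ _

theorem permMap_one : permMap π s 1 = 𝟙 _ := by
  apply WidePullback.hom_ext
  · intro i
    rw [permMap_proj, Category.id_comp, inv_one, Equiv.Perm.one_apply]
  · rw [permMap_base, Category.id_comp]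

theorem permMap_mul (σ τ : Equiv.Perm (Fin s)) :
    permMap π s (σ * τ) = permMap π s τ ≫ permMap π s σ := by
  apply WidePullback.hom_ext
  · intro i
    rw [permMap_proj, Category.assoc, permMap_proj, permMap_proj, mul_inv_rev,
      Equiv.Perm.mul_apply]
  · rw [permMap_base, Category.assoc, permMap_base, permMap_base]

/-- The largest open subset of `Z` over which `π` is finite étale. Over an irreducible `Z`, the
degree of `π` over this open subset is constant, equal to the degree of the generic fibre; so
this is where `π` is étale with all fibres of degree `deg π`. -/
def etaleLocus : Z.Opens := sSup {V : Z.Opens | IsFinite (π ∣_ V) ∧ Etale (π ∣_ V)}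

/-- The big diagonal: the union over `i ≠ j` of the loci where the `i`-th and `j`-th projections
agree (as morphisms of schemes). -/
def bigDiagonal : Set (fiberPower π s) :=
  ⋃ (i : Fin s) (j : Fin s) (_ : i ≠ j),
    Set.range (equalizer.ι (fiberPowerProj π s i) (fiberPowerProj π s j))

/-- The closure in the `s`-fold fibre product of the complement of the big diagonal in the part
that lies over the étale locus. -/
def distinctPower : Set (fiberPower π s) :=
  closure ((fiberPowerBase π s) ⁻¹' (etaleLocus π : Set Z) \ bigDiagonal π s)

/-- `X'` is an irreducible component of the closed subset `distinctPower π s`. -/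
def IsComponent (X' : Set (fiberPower π s)) : Prop :=
  Maximal (fun T : Set (fiberPower π s) => IsIrreducible T ∧ T ⊆ distinctPower π s) X'

/-- The subgroup of the symmetric group that preserves a given subset `X'` of the fibre power. -/
def monodromyGroup (X' : Set (fiberPower π s)) : Subgroup (Equiv.Perm (Fin s)) where
  carrier := {σ | permMap π s σ '' X' = X'}
  one_mem' := by
    simp only [Set.mem_ofPred_eq, permMap_one]
    simp
  mul_mem' {σ τ} hσ hτ := by
    simp only [Set.mem_ofPred_eq] at hσ hτ ⊢
    rw [permMap_mul, Scheme.Hom.comp_base, TopCat.coe_comp, Set.image_comp, hτ, hσ]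
  inv_mem' {σ} hσ := by
    simp only [Set.mem_ofPred_eq] at hσ ⊢
    conv_lhs => rw [← hσ]
    rw [← Set.image_comp, ← TopCat.coe_comp, ← Scheme.Hom.comp_base, ← permMap_mul,
      inv_mul_cancel, permMap_one]
    simp

end Monodromy

end BranchedCover

end

open BranchedCover

/-!
Write `K = k(Z)`, `L = k(X)` and `N` for the normal closure of `L / K`. The idea is to identify the
generic points of the irreducible components of `distinctPower π d` with Galois orbits of
numberings of the embeddings `L → N`, in a way that respects the action of the symmetric group.

A numbering `e` of the `d` embeddings gives an `N`-valued point `tuple` of the fibre power, lying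
over the generic point of `Z`; let `tuplePoint e` be the underlying point. It avoids the big
diagonal since the embeddings are distinct. Conversely, the residue field of a point `w` of the
fibre power over the generic point of `Z` receives `d` maps from `L`; off the big diagonal these
are distinct, and the subfield that they generate embeds into `N`, so that `w = tuplePoint e` for
some `e` (`exists_labelling_tuplePoint_eq`). Since `N` is generated by the images of its embeddings
of `L`, the residue field at `tuplePoint e` maps isomorphically onto `N`, whence
`tuplePoint e = tuplePoint e'` exactly when `e'` is obtained from `e` by composing with an
automorphism of `N` over `K` (`tuplePoint_eq_iff`).

The fibre power is flat over the finite étale locus, so generizations lift, and every point there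
specializes from a point over the generic point of `Z` (`exists_specializes_of_mem_etaleLocus`). As
the big diagonal is closed, every point over that locus and off the big diagonal specializes from
some `tuplePoint e`. These finitely many points lie over the étale locus, because the extension `L
/ K` is finite separable and so `π` is finite étale over a neighbourhood of the generic point
(`genericPoint_mem_etaleLocus`). Hence the components of `distinctPower π d` are the closures of
the points `tuplePoint e`.

A permutation `σ` sends `tuplePoint e` to `tuplePoint (e ∘ σ⁻¹)`, so it preserves the closure of
`tuplePoint e` if and only if `e ∘ σ⁻¹` and `e` differ by an automorphism of `N`, which says that
`σ` is in the image of `galoisPerm e` (`monodromyGroup_closure_tuplePoint`). A different choice of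
`e` conjugates this image (`galoisPerm_range_eq_map_conj`).
-/

noncomputable section

namespace BranchedCover

/-! ### Embeddings into the normal closure -/

section FieldTheory

variable {F : Type u} {E : Type v} [Field F] [Field E] [Algebra F E]

/-- A separating transcendence basis of an algebraic extension is empty. -/
theorem IsSeparablyGenerated.isSeparable [Algebra.IsAlgebraic F E]
    (h : IsSeparablyGenerated F E) : Algebra.IsSeparable F E := by
  obtain ⟨s, hs, hsep⟩ := h
  have hs' : IsEmpty s := hs.isEmpty_iff_isAlgebraic.mpr ‹_›
  rw [Set.isEmpty_coe_sort] at hs'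
  subst hs'
  rw [IntermediateField.adjoin_empty] at hsep
  exact Algebra.IsSeparable.of_equiv_equiv (IntermediateField.botEquiv F E).toRingEquiv
    (RingEquiv.refl E) (by
      ext x
      obtain ⟨y, rfl⟩ := (IntermediateField.botEquiv F E).symm.surjective x
      simp)

theorem nonempty_labelling [FiniteDimensional F E] [Algebra.IsSeparable F E] :
    Nonempty (Labelling F E (Module.finrank F E)) := by
  have h := AlgHom.card F E (AlgebraicClosure E)
  rw [← Nat.card_eq_fintype_card, ← Nat.card_congr
    (normalClosure.algHomEquiv F E (AlgebraicClosure E))] at h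
  have : Finite (E →ₐ[F] NormClosure F E) := inferInstance
  exact ⟨(Finite.equivFinOfCardEq h).symm⟩

/-- The images of the embeddings of `E` generate its normal closure, so an embedding of a field
into the normal closure is surjective once its image contains all of them. -/
theorem surjective_of_fieldRange_le {M : Type*} [Field M] [Algebra F M]
    (φ : M →ₐ[F] NormClosure F E)
    (h : ∀ f : E →ₐ[F] NormClosure F E, f.fieldRange ≤ φ.fieldRange) :
    Function.Surjective φ := by
  let N := IntermediateField.normalClosure F E (AlgebraicClosure E)
  have hN : N ≤ (N.val.comp φ).fieldRange := by
    rw [normalClosure_le_iff]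
    rintro f _ ⟨x, rfl⟩
    obtain ⟨y, hy⟩ := h ((normalClosure.algHomEquiv F E (AlgebraicClosure E)).symm f) ⟨x, rfl⟩
    exact ⟨y, congrArg N.val hy⟩
  intro x
  obtain ⟨y, hy⟩ := hN x.2
  exact ⟨y, Subtype.ext hy⟩

theorem labelling_galoisPerm_apply {d : ℕ} (e : Labelling F E d)
    (g : NormClosure F E ≃ₐ[F] NormClosure F E) (i : Fin d) (x : E) :
    e (galoisPerm e g i) x = g (e i x) := by
  simp [galoisPerm]

/-- The Galois group acts faithfully on the embeddings: the fixed field of an automorphism that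
fixes every embedding contains the image of each of them. -/
theorem galoisPerm_injective {d : ℕ} (e : Labelling F E d) :
    Function.Injective (galoisPerm e) := by
  rw [injective_iff_map_eq_one]
  intro g hg
  have h : Function.Surjective (IntermediateField.fixedField (Subgroup.zpowers g)).val := by
    refine surjective_of_fieldRange_le _ ?_
    rintro f _ ⟨x, rfl⟩
    rw [IntermediateField.fieldRange_val, IntermediateField.mem_fixedField_iff]
    rintro _ ⟨n, rfl⟩
    have h1 := labelling_galoisPerm_apply e (g ^ n) (e.symm f) x
    rw [map_zpow, hg, one_zpow, Equiv.Perm.one_apply, Equiv.apply_symm_apply] at h1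
    exact h1.symm
  ext1 x
  obtain ⟨y, rfl⟩ := h x
  exact (IntermediateField.mem_fixedField_iff _ _).mp y.2 g (Subgroup.mem_zpowers g)

/-- If `E / F` has `d` embeddings into its normal closure, then any `d` distinct embeddings `c` of
`E` into a field `M` are, up to a change of field, a numbering `e` of the former: the subfield `M'`
of `M` generated by the images of `c` maps to the algebraic closure of `E`, carrying `c` to `e`. -/
theorem exists_labelling_of_embeddings [FiniteDimensional F E] {d : ℕ} (e₀ : Labelling F E d)
    {M : Type*} [Field M] [Algebra F M] (c : Fin d → (E →ₐ[F] M)) (hc : Function.Injective c) :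
    ∃ (e : Labelling F E d) (M' : IntermediateField F M) (c' : Fin d → (E →ₐ[F] M'))
      (ψ : M' →ₐ[F] AlgebraicClosure E), (∀ i, M'.val.comp (c' i) = c i) ∧
      ∀ i, ψ.comp (c' i) =
        (IntermediateField.normalClosure F E (AlgebraicClosure E)).val.comp (e i) := by
  let M' : IntermediateField F M := ⨆ i, (c i).fieldRange
  have : FiniteDimensional F M' := by
    have : ∀ i, FiniteDimensional F (c i).fieldRange := fun i ↦
      (c i).toLinearMap.finiteDimensional_range
    exact IntermediateField.finiteDimensional_iSup_of_finite
  let c' : Fin d → (E →ₐ[F] M') := fun i ↦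
    (c i).codRestrict M'.toSubalgebra fun x ↦ le_iSup (fun i ↦ (c i).fieldRange) i ⟨x, rfl⟩
  let ψ : M' →ₐ[F] AlgebraicClosure E := IsAlgClosed.lift
  let f : Fin d → (E →ₐ[F] NormClosure F E) := fun i ↦
    (normalClosure.algHomEquiv F E (AlgebraicClosure E)).symm (ψ.comp (c' i))
  have hf : Function.Injective f := by
    intro i j hij
    apply hc
    have h1 := (normalClosure.algHomEquiv F E (AlgebraicClosure E)).symm.injective hij
    ext x
    have h2 := ψ.injective (DFunLike.congr_fun h1 x)
    exact congrArg Subtype.val h2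
  have hfb : Function.Bijective f := by
    have hb := Finite.injective_iff_bijective.mp (e₀.symm.injective.comp hf)
    exact (Function.Bijective.of_comp_iff' e₀.symm.bijective f).mp hb
  refine ⟨Equiv.ofBijective f hfb, M', c', ψ, fun i ↦ by ext; rfl, fun i ↦ ?_⟩
  exact ((normalClosure.algHomEquiv F E (AlgebraicClosure E)).apply_symm_apply
    (ψ.comp (c' i))).symm

end FieldTheory

/-! ### Generic points and function fields -/

section GenericPoint

/-- The unique point of the spectrum of a field. -/
def specPoint (M : Type u) [Field M] : Spec (CommRingCat.of M) := IsLocalRing.closedPoint M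

theorem eq_specPoint {M : Type u} [Field M] (x : Spec (CommRingCat.of M)) : x = specPoint M :=
  (inferInstance : Subsingleton (PrimeSpectrum M)).elim _ _

variable {X Z : Scheme.{u}} [IsIntegral X] [IsIntegral Z]

/-- The inclusion of the generic point `Spec k(X) ⟶ X`. -/
abbrev fromSpecFunctionField (X : Scheme.{u}) [IsIntegral X] : Spec X.functionField ⟶ X :=
  X.fromSpecStalk (genericPoint X)

theorem fromSpecFunctionField_apply (x : Spec X.functionField) :
    fromSpecFunctionField X x = genericPoint X := by
  have : x = IsLocalRing.closedPoint X.functionField :=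
    (inferInstance : Subsingleton (PrimeSpectrum X.functionField)).elim _ _
  rw [this, Scheme.fromSpecStalk_closedPoint]

/-- A field-valued point that lies at the generic point of `X` factors through `Spec k(X)`. -/
theorem exists_eq_specMap_comp_fromSpecFunctionField {F : Type u} [Field F]
    (f : Spec (CommRingCat.of F) ⟶ X) (hf : f (specPoint F) = genericPoint X) :
    ∃ φ : X.functionField ⟶ CommRingCat.of F, f = Spec.map φ ≫ fromSpecFunctionField X := by
  -- The statement for an arbitrary point allows `f (specPoint F) = x` to be substituted.
  have key : ∀ x : X, f (specPoint F) = x →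
      ∃ φ : X.presheaf.stalk x ⟶ CommRingCat.of F, f = Spec.map φ ≫ X.fromSpecStalk x := by
    rintro _ rfl
    exact ⟨_, (Scheme.Spec_stalkClosedPointTo_fromSpecStalk f).symm⟩
  exact key _ hf

variable (π : X ⟶ Z) [IsDominant π]

theorem specMap_functionFieldMap :
    Spec.map (CommRingCat.ofHom (functionFieldMap π)) ≫ fromSpecFunctionField Z =
      fromSpecFunctionField X ≫ π := by
  rw [functionFieldMap, CommRingCat.ofHom_hom, Spec.map_comp, Category.assoc,
    Scheme.SpecMap_stalkSpecializes_fromSpecStalk, Scheme.SpecMap_stalkMap_fromSpecStalk]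

/-- If `k(X) / k(Z)` is algebraic, then the generic point is the only point of the generic fibre:
the local ring of any such point is integral over `k(Z)`, hence a field. -/
theorem eq_genericPoint_of_map_eq
    (halg : letI := functionFieldAlgebra π; Algebra.IsAlgebraic Z.functionField X.functionField)
    {x : X} (hx : π x = genericPoint Z) : x = genericPoint X := by
  let := functionFieldAlgebra π
  let φ : Z.functionField ⟶ X.presheaf.stalk x :=
    Z.presheaf.stalkSpecializes (specializes_of_eq hx) ≫ π.stalkMap x
  have hsp : genericPoint X ⤳ x := genericPoint_specializes x
  have hφ : φ ≫ X.presheaf.stalkSpecializes hsp = CommRingCat.ofHom (functionFieldMap π) := by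
    simp only [φ, functionFieldMap, CommRingCat.ofHom_hom, Category.assoc]
    rw [← Scheme.Hom.stalkSpecializes_stalkMap π _ _ hsp,
      TopCat.Presheaf.stalkSpecializes_comp_assoc]
  let : Algebra Z.functionField (X.presheaf.stalk x) := φ.hom.toAlgebra
  have : IsScalarTower Z.functionField (X.presheaf.stalk x) X.functionField :=
    .of_algebraMap_eq' (congrArg CommRingCat.Hom.hom hφ).symm
  have : Algebra.IsIntegral Z.functionField (X.presheaf.stalk x) := by
    constructor
    intro y
    rw [← isIntegral_algebraMap_iff
      (IsFractionRing.injective (X.presheaf.stalk x) X.functionField)]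
    exact Algebra.IsIntegral.isIntegral _
  have hfield : IsField (X.presheaf.stalk x) :=
    isField_of_isIntegral_of_isField' (Field.toIsField Z.functionField)
  have hsub : Subsingleton (Spec (X.presheaf.stalk x)) :=
    (inferInstance : Subsingleton (@PrimeSpectrum _ hfield.toField.toSemifield.toCommSemiring))
  have h1 : genericPoint X ∈ Set.range (X.fromSpecStalk x) := by
    rw [Scheme.range_fromSpecStalk]; exact hsp
  obtain ⟨y, hy⟩ := h1
  rw [← hy, hsub.elim y (IsLocalRing.closedPoint _), Scheme.fromSpecStalk_closedPoint]

end GenericPoint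

/-! ### Finiteness of the extension of function fields -/

section Finite

open Algebra Field IntermediateField

variable {k : Type u} [Field k] {X Z : Scheme.{u}} [IsIntegral X] [IsIntegral Z]

/-- The function field of a variety over `k` is finitely generated as a field over `k`. -/
theorem essFiniteType_constantsMap (sX : X ⟶ Spec (CommRingCat.of k)) [LocallyOfFiniteType sX] :
    (constantsMap sX).EssFiniteType := by
  obtain ⟨_, ⟨W, hW, rfl⟩, hxW, -⟩ :=
    X.isBasis_affineOpens.exists_subset_of_mem_open (Set.mem_univ (genericPoint X)) isOpen_univ
  have : Nonempty W := ⟨⟨_, hxW⟩⟩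
  have hfrac := functionField_isFractionRing_of_isAffineOpen X W hW
  have h1 : (X.germToFunctionField W).hom.EssFiniteType :=
    Algebra.EssFiniteType.of_isLocalization _ (nonZeroDivisors Γ(X, W))
  have h2 : (sX.appLE ⊤ W le_top).hom.FiniteType :=
    sX.finiteType_appLE (isAffineOpen_top _) hW le_top
  have h3 : (Scheme.ΓSpecIso (CommRingCat.of k)).inv.hom.FiniteType :=
    RingHom.FiniteType.of_surjective _
      (Scheme.ΓSpecIso (CommRingCat.of k)).symm.commRingCatIsoToRingEquiv.surjective
  have h4 : constantsMap sX = ((X.germToFunctionField W).hom.comp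
      ((sX.appLE ⊤ W le_top).hom.comp (Scheme.ΓSpecIso (CommRingCat.of k)).inv.hom)) := by
    rw [← CommRingCat.hom_comp, ← CommRingCat.hom_comp, constantsMap]
    congr 1
    rw [Category.assoc]
    exact congrArg (fun φ ↦ (Scheme.ΓSpecIso (CommRingCat.of k)).inv ≫ sX.appTop ≫ φ)
      (X.presheaf.germ_res (homOfLE le_top) _ hxW).symm
  rw [h4]
  exact (h3.essFiniteType.comp h2.essFiniteType).comp h1

theorem functionFieldMap_comp_constantsMap (sX : X ⟶ Spec (CommRingCat.of k))
    (sZ : Z ⟶ Spec (CommRingCat.of k)) (π : X ⟶ Z) (hπ : π ≫ sZ = sX) [IsDominant π] :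
    (functionFieldMap π).comp (constantsMap sZ) = constantsMap sX := by
  subst hπ
  rw [functionFieldMap, constantsMap, constantsMap, ← CommRingCat.hom_comp]
  congr 1
  have h : Z.presheaf.germ ⊤ (genericPoint Z) trivial ≫
      Z.presheaf.stalkSpecializes (specializes_of_eq (map_genericPoint π)) ≫
        π.stalkMap (genericPoint X) = π.appTop ≫ X.presheaf.germ ⊤ (genericPoint X) trivial :=
    (congrArg (· ≫ π.stalkMap _) (Z.presheaf.germ_stalkSpecializes (U := ⊤) trivial
      (specializes_of_eq (map_genericPoint π)))).trans (π.germ_stalkMap ⊤ (genericPoint X) trivial)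
  rw [Scheme.Hom.comp_appTop, Category.assoc, Category.assoc, Category.assoc, h]

/-- For varieties of the same dimension, additivity of the transcendence degree makes `k(X)`
finite over `k(Z)`. -/
theorem finite_functionField (sX : X ⟶ Spec (CommRingCat.of k))
    (sZ : Z ⟶ Spec (CommRingCat.of k)) [LocallyOfFiniteType sX] [LocallyOfFiniteType sZ]
    (π : X ⟶ Z) (hπ : π ≫ sZ = sX) [IsDominant π] (hdim : dimension sX = dimension sZ) :
    letI := functionFieldAlgebra π
    FiniteDimensional Z.functionField X.functionField := by
  let := functionFieldAlgebra π
  let : Algebra k X.functionField := (constantsMap sX).toAlgebra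
  let : Algebra k Z.functionField := (constantsMap sZ).toAlgebra
  have : IsScalarTower k Z.functionField X.functionField :=
    .of_algebraMap_eq' (functionFieldMap_comp_constantsMap sX sZ π hπ).symm
  have hX : Algebra.EssFiniteType k X.functionField := essFiniteType_constantsMap sX
  have hZ : Algebra.EssFiniteType k Z.functionField := essFiniteType_constantsMap sZ
  have : Algebra.EssFiniteType Z.functionField X.functionField := .of_comp k _ _
  have hlt : Algebra.trdeg k Z.functionField < Cardinal.aleph0 := trdeg_lt_aleph0 _ _
  have h0 : Algebra.trdeg Z.functionField X.functionField = 0 := by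
    have h1 := trdeg_add_eq k Z.functionField (A := X.functionField)
    change Algebra.trdeg k X.functionField = Algebra.trdeg k Z.functionField at hdim
    rw [hdim] at h1
    exact Cardinal.eq_of_add_eq_add_left (h1.trans (add_zero _).symm) hlt
  have : Algebra.IsAlgebraic Z.functionField X.functionField := trdeg_eq_zero_iff.mp h0
  exact Algebra.finite_of_essFiniteType_of_isAlgebraic

end Finite

/-! ### Points of the fibre power over the generic point -/

section Tuple

theorem fromSpecResidueField_specPoint {Y : Scheme.{u}} (y : Y) :
    Y.fromSpecResidueField y (specPoint (Y.residueField y)) = y :=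
  Scheme.fromSpecResidueField_apply y _

theorem exists_eq_specMap_comp_fromSpecResidueField {M : Type u} [Field M] {Y : Scheme.{u}}
    (f : Spec (CommRingCat.of M) ⟶ Y) {y : Y} (hy : f (specPoint M) = y) :
    ∃ a : Y.residueField y →+* M,
      f = Spec.map (CommRingCat.ofHom a) ≫ Y.fromSpecResidueField y := by
  subst hy
  exact ⟨_, (Scheme.descResidueField_stalkClosedPointTo_fromSpecResidueField M Y f).symm⟩

variable {X Z : Scheme.{u}} [IsIntegral X] [IsIntegral Z]

theorem fromSpecFunctionField_cancel {M : Type u} [Field M] {a b : X.functionField →+* M}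
    (h : Spec.map (CommRingCat.ofHom a) ≫ fromSpecFunctionField X =
      Spec.map (CommRingCat.ofHom b) ≫ fromSpecFunctionField X) : a = b := by
  rw [cancel_mono] at h
  exact congrArg CommRingCat.Hom.hom (Spec.map_injective h)

variable {π : X ⟶ Z} [IsDominant π] [Algebra Z.functionField X.functionField]
  (hπ : algebraMap Z.functionField X.functionField = functionFieldMap π) {d : ℕ}
  {M : Type u} [Field M] [Algebra Z.functionField M]

theorem specMap_algHom_comp
    (hπ : algebraMap Z.functionField X.functionField = functionFieldMap π)
    (c : X.functionField →ₐ[Z.functionField] M) :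
    (Spec.map (CommRingCat.ofHom (c : X.functionField →+* M)) ≫ fromSpecFunctionField X) ≫ π =
      Spec.map (CommRingCat.ofHom (algebraMap Z.functionField M)) ≫ fromSpecFunctionField Z := by
  rw [Category.assoc, ← specMap_functionFieldMap, ← Spec.map_comp_assoc, ← hπ,
    ← CommRingCat.ofHom_comp, c.comp_algebraMap]

/-- The `M`-valued point of the fibre power given by a family of `k(Z)`-embeddings
`k(X) → M`. -/
def tuple (c : Fin d → (X.functionField →ₐ[Z.functionField] M)) :
    Spec (CommRingCat.of M) ⟶ fiberPower π d :=
  WidePullback.lift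
    (Spec.map (CommRingCat.ofHom (algebraMap Z.functionField M)) ≫ fromSpecFunctionField Z)
    (fun i ↦ Spec.map (CommRingCat.ofHom (c i : X.functionField →+* M)) ≫ fromSpecFunctionField X)
    (fun i ↦ specMap_algHom_comp hπ (c i))

variable (c : Fin d → (X.functionField →ₐ[Z.functionField] M))

theorem tuple_proj (i : Fin d) : tuple hπ c ≫ fiberPowerProj π d i =
    Spec.map (CommRingCat.ofHom (c i : X.functionField →+* M)) ≫ fromSpecFunctionField X :=
  WidePullback.lift_π _ _ _ _ _

theorem tuple_base : tuple hπ c ≫ fiberPowerBase π d =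
    Spec.map (CommRingCat.ofHom (algebraMap Z.functionField M)) ≫ fromSpecFunctionField Z :=
  WidePullback.lift_base _ _ _ _

/-- Permuting the factors of the fibre power renumbers the embeddings. -/
theorem tuple_permMap (σ : Equiv.Perm (Fin d)) :
    tuple hπ c ≫ permMap π d σ = tuple hπ (c ∘ ⇑σ⁻¹) := by
  apply WidePullback.hom_ext
  · intro i
    rw [Category.assoc, permMap_proj, tuple_proj, tuple_proj]
  · rw [Category.assoc, permMap_base, tuple_base, tuple_base]

variable {M' : Type u} [Field M'] [Algebra Z.functionField M']

theorem specMap_tuple (φ : M →ₐ[Z.functionField] M') :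
    Spec.map (CommRingCat.ofHom (φ : M →+* M')) ≫ tuple hπ c = tuple hπ fun i ↦ φ.comp (c i) := by
  apply WidePullback.hom_ext
  · intro i
    rw [Category.assoc, tuple_proj, tuple_proj, ← Spec.map_comp_assoc, ← CommRingCat.ofHom_comp]
    rfl
  · rw [Category.assoc, tuple_base, tuple_base, ← Spec.map_comp_assoc, ← CommRingCat.ofHom_comp,
      φ.comp_algebraMap]

/-- A ring map that carries one tuple of embeddings to another, as points of the fibre power, is
`k(Z)`-linear and carries the embeddings to one another. -/
theorem comp_eq_of_specMap_tuple (a : M →+* M')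
    (c' : Fin d → (X.functionField →ₐ[Z.functionField] M'))
    (h : Spec.map (CommRingCat.ofHom a) ≫ tuple hπ c = tuple hπ c') :
    ∃ φ : M →ₐ[Z.functionField] M', ∀ i, φ.comp (c i) = c' i := by
  have hbase : a.comp (algebraMap Z.functionField M) = algebraMap Z.functionField M' := by
    apply fromSpecFunctionField_cancel
    rw [← tuple_base hπ c', ← h, Category.assoc, tuple_base, CommRingCat.ofHom_comp,
      Spec.map_comp_assoc]
  refine ⟨{ a with commutes' := fun r ↦ DFunLike.congr_fun hbase r }, fun i ↦ ?_⟩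
  have hi : a.comp (c i : X.functionField →+* M) = c' i := by
    apply fromSpecFunctionField_cancel
    rw [← tuple_proj hπ c', ← h, Category.assoc, tuple_proj, CommRingCat.ofHom_comp,
      Spec.map_comp_assoc]
  ext x
  exact DFunLike.congr_fun hi x

/-- Every field-valued point of the fibre power over the generic point of `Z` is a tuple of
embeddings of `k(X)`. -/
theorem exists_eq_tuple
    (hπ : algebraMap Z.functionField X.functionField = functionFieldMap π)
    [Algebra.IsAlgebraic Z.functionField X.functionField]
    {M : Type u} [Field M] (f : Spec (CommRingCat.of M) ⟶ fiberPower π d)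
    (hf : fiberPowerBase π d (f (specPoint M)) = genericPoint Z) :
    ∃ (_ : Algebra Z.functionField M) (c : Fin d → (X.functionField →ₐ[Z.functionField] M)),
      f = tuple hπ c := by
  obtain ⟨β, hβ⟩ := exists_eq_specMap_comp_fromSpecFunctionField (f ≫ fiberPowerBase π d)
    (by rw [Scheme.Hom.comp_apply, hf])
  let : Algebra Z.functionField M := β.hom.toAlgebra
  have hproj : ∀ i, ∃ φ : X.functionField ⟶ CommRingCat.of M,
      f ≫ fiberPowerProj π d i = Spec.map φ ≫ fromSpecFunctionField X := by
    intro i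
    apply exists_eq_specMap_comp_fromSpecFunctionField
    apply eq_genericPoint_of_map_eq π
    · convert ‹Algebra.IsAlgebraic Z.functionField X.functionField›
      exact Algebra.algebra_ext _ _ fun r ↦ (DFunLike.congr_fun hπ r).symm
    · rw [← Scheme.Hom.comp_apply, Category.assoc, WidePullback.π_arrow, Scheme.Hom.comp_apply, hf]
  choose φ hφ using hproj
  have hcomm : ∀ i, (φ i).hom.comp (algebraMap Z.functionField X.functionField) = β.hom := by
    intro i
    apply fromSpecFunctionField_cancel
    rw [hπ, CommRingCat.ofHom_comp, Spec.map_comp_assoc, specMap_functionFieldMap,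
      CommRingCat.ofHom_hom, CommRingCat.ofHom_hom, ← Category.assoc, ← hφ, ← hβ, Category.assoc,
      WidePullback.π_arrow]
  refine ⟨this, fun i ↦ { (φ i).hom with commutes' := fun r ↦ DFunLike.congr_fun (hcomm i) r },
    ?_⟩
  apply WidePullback.hom_ext
  · intro i
    rw [tuple_proj]
    exact hφ i
  · rw [tuple_base]
    exact hβ

/-- The point of the fibre power underlying a tuple of embeddings. -/
def tuplePoint : fiberPower π d := tuple hπ c (specPoint M)

theorem fiberPowerBase_tuplePoint : fiberPowerBase π d (tuplePoint hπ c) = genericPoint Z := by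
  rw [tuplePoint, ← Scheme.Hom.comp_apply, tuple_base, Scheme.Hom.comp_apply,
    eq_specPoint (Spec.map _ _)]
  exact fromSpecFunctionField_apply _

theorem permMap_tuplePoint (σ : Equiv.Perm (Fin d)) :
    permMap π d σ (tuplePoint hπ c) = tuplePoint hπ (c ∘ ⇑σ⁻¹) := by
  rw [tuplePoint, ← Scheme.Hom.comp_apply, tuple_permMap, tuplePoint]

/-- Enlarging the field of definition of a tuple does not change the underlying point. -/
theorem tuplePoint_comp (φ : M →ₐ[Z.functionField] M') :
    tuplePoint hπ (fun i ↦ φ.comp (c i)) = tuplePoint hπ c := by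
  rw [tuplePoint, ← specMap_tuple, Scheme.Hom.comp_apply, eq_specPoint (Spec.map _ _), tuplePoint]

theorem tuplePoint_mem_bigDiagonal_iff :
    tuplePoint hπ c ∈ bigDiagonal π d ↔ ¬ Function.Injective c := by
  simp only [bigDiagonal, Set.mem_iUnion, Function.Injective, not_forall]
  constructor
  · rintro ⟨i, j, hij, w, hw⟩
    refine ⟨i, j, ?_, hij⟩
    -- A point `t` of the fibre product of `tuple hπ c` with the equalizer gives a field extension
    -- of `M` over which `c i` and `c j` agree.
    obtain ⟨t, -, -⟩ := Scheme.Pullback.exists_preimage_pullback (f := tuple hπ c)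
      (g := equalizer.ι (fiberPowerProj π d i) (fiberPowerProj π d j)) _ w hw.symm
    let p := (pullback (tuple hπ c)
      (equalizer.ι (fiberPowerProj π d i) (fiberPowerProj π d j))).fromSpecResidueField t
    obtain ⟨a, ha⟩ : ∃ a : CommRingCat.of M ⟶ _, p ≫ pullback.fst _ _ = Spec.map a :=
      ⟨Spec.preimage _, (Spec.map_preimage _).symm⟩
    have h1 : Spec.map a ≫ tuple hπ c ≫ fiberPowerProj π d i =
        Spec.map a ≫ tuple hπ c ≫ fiberPowerProj π d j := by
      rw [← ha, Category.assoc, pullback.condition_assoc, Category.assoc,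
        pullback.condition_assoc, equalizer.condition]
    rw [tuple_proj, tuple_proj, ← Spec.map_comp_assoc, ← Spec.map_comp_assoc, cancel_mono] at h1
    have h2 := Spec.map_injective h1
    ext x
    exact a.hom.injective (DFunLike.congr_fun (congrArg CommRingCat.Hom.hom h2) x)
  · rintro ⟨i, j, hc, hij⟩
    refine ⟨i, j, hij, equalizer.lift (tuple hπ c) ?_ (specPoint M), ?_⟩
    · rw [tuple_proj, tuple_proj, hc]
    · rw [← Scheme.Hom.comp_apply, equalizer.lift_ι, tuplePoint]

end Tuple

section Labelling

variable {X Z : Scheme.{u}} [IsIntegral X] [IsIntegral Z]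
variable {π : X ⟶ Z} [IsDominant π] [Algebra Z.functionField X.functionField]
  (hπ : algebraMap Z.functionField X.functionField = functionFieldMap π) {d : ℕ}

/-- The points of the generic fibre of the fibre power off the big diagonal are given by
numberings of the embeddings of `k(X)` into its normal closure. The numbering `e₀` only serves to
say that there are exactly `d` embeddings. -/
theorem exists_labelling_tuplePoint_eq [FiniteDimensional Z.functionField X.functionField]
    (e₀ : Labelling Z.functionField X.functionField d) {w : fiberPower π d}
    (hw : fiberPowerBase π d w = genericPoint Z) (hwd : w ∉ bigDiagonal π d) :
    ∃ e : Labelling Z.functionField X.functionField d, tuplePoint hπ e = w := by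
  obtain ⟨_, c, hc⟩ := exists_eq_tuple hπ (M := (fiberPower π d).residueField w)
    ((fiberPower π d).fromSpecResidueField w)
    (by rw [fromSpecResidueField_specPoint, hw])
  have hcw : tuplePoint hπ c = w := by
    rw [tuplePoint, ← hc, fromSpecResidueField_specPoint]
  have hinj : Function.Injective c := by
    by_contra h
    rw [← tuplePoint_mem_bigDiagonal_iff hπ, hcw] at h
    exact hwd h
  obtain ⟨e, M', c', ψ, h1, h2⟩ := exists_labelling_of_embeddings e₀ c hinj
  refine ⟨e, ?_⟩
  rw [← hcw, ← tuplePoint_comp hπ e (IntermediateField.val _)]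
  simp only [← h2]
  rw [tuplePoint_comp, ← tuplePoint_comp hπ c' M'.val]
  simp only [h1]

/-- Two numberings give the same point of the fibre power if and only if they differ by an
automorphism of the normal closure: the residue field at that point is isomorphic to the normal
closure by means of either numbering. -/
theorem tuplePoint_eq_iff [Algebra.IsAlgebraic Z.functionField X.functionField]
    (e e' : Labelling Z.functionField X.functionField d) :
    tuplePoint hπ e = tuplePoint hπ e' ↔
      ∃ g : NormClosure Z.functionField X.functionField ≃ₐ[Z.functionField]
          NormClosure Z.functionField X.functionField,
        ∀ i, (g : NormClosure Z.functionField X.functionField →ₐ[Z.functionField]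
          NormClosure Z.functionField X.functionField).comp (e i) = e' i := by
  constructor
  · intro h
    set w := tuplePoint hπ e with hw
    obtain ⟨_, c, hc⟩ := exists_eq_tuple hπ (M := (fiberPower π d).residueField w)
      ((fiberPower π d).fromSpecResidueField w)
      (by rw [fromSpecResidueField_specPoint, hw, fiberPowerBase_tuplePoint])
    have key : ∀ e'' : Labelling Z.functionField X.functionField d, tuplePoint hπ e'' = w →
        ∃ φ : (fiberPower π d).residueField w →ₐ[Z.functionField]
          NormClosure Z.functionField X.functionField, Function.Bijective φ ∧
          ∀ i, φ.comp (c i) = e'' i := by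
      intro e'' he''
      obtain ⟨a, ha⟩ := exists_eq_specMap_comp_fromSpecResidueField (tuple hπ e'') he''
      rw [hc] at ha
      obtain ⟨φ, hφ⟩ := comp_eq_of_specMap_tuple hπ c a e'' ha.symm
      refine ⟨φ, ⟨φ.injective, surjective_of_fieldRange_le φ fun f ↦ ?_⟩, hφ⟩
      rw [← e''.apply_symm_apply f, ← hφ]
      rintro _ ⟨x, rfl⟩
      exact ⟨_, rfl⟩
    obtain ⟨φ, hφ, hφc⟩ := key e rfl
    obtain ⟨φ', hφ', hφc'⟩ := key e' h.symm
    refine ⟨(AlgEquiv.ofBijective φ hφ).symm.trans (AlgEquiv.ofBijective φ' hφ'), fun i ↦ ?_⟩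
    ext1 x
    rw [← hφc, ← hφc']
    exact congrArg φ' ((AlgEquiv.ofBijective φ hφ).symm_apply_apply (c i x))
  · rintro ⟨g, hg⟩
    rw [← tuplePoint_comp hπ e
      (g : NormClosure Z.functionField X.functionField →ₐ[Z.functionField]
          NormClosure Z.functionField X.functionField)]
    simp only [hg]

end Labelling

/-! ### Generization over the étale locus -/

section Generization

variable {X Z : Scheme.{u}} (π : X ⟶ Z)

theorem isIso_fiberPowerBase_zero : IsIso (fiberPowerBase π 0) := by
  refine ⟨WidePullback.lift (𝟙 Z) (fun i : Fin 0 ↦ i.elim0) (fun i ↦ i.elim0), ?_, ?_⟩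
  · apply WidePullback.hom_ext
    · exact fun i ↦ i.elim0
    · rw [Category.assoc, WidePullback.lift_base, Category.comp_id, Category.id_comp]
  · rw [WidePullback.lift_base]

/-- `X^(n + 1) ≅ X^n ×_Z X`, the last factor on the right being the one with index `0`. -/
def fiberPowerSuccIso (n : ℕ) : fiberPower π (n + 1) ≅ pullback (fiberPowerBase π n) π where
  hom := pullback.lift
    (WidePullback.lift (fiberPowerBase π (n + 1)) (fun i ↦ fiberPowerProj π (n + 1) i.succ)
      (fun _ ↦ WidePullback.π_arrow _ _))
    (fiberPowerProj π (n + 1) 0)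
    (by rw [WidePullback.lift_base, WidePullback.π_arrow])
  inv := WidePullback.lift (pullback.fst _ _ ≫ fiberPowerBase π n)
    (Fin.cases (pullback.snd _ _) (fun i ↦ pullback.fst _ _ ≫ fiberPowerProj π n i))
    (fun i ↦ by
      cases i using Fin.cases with
      | zero => exact pullback.condition.symm
      | succ i =>
        simp only [Fin.cases_succ, Category.assoc]
        rw [WidePullback.π_arrow])
  hom_inv_id := by
    apply WidePullback.hom_ext
    · intro i
      rw [Category.assoc, WidePullback.lift_π, Category.id_comp]
      cases i using Fin.cases with
      | zero => exact pullback.lift_snd _ _ _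
      | succ i =>
        simp only [Fin.cases_succ]
        rw [pullback.lift_fst_assoc, WidePullback.lift_π]
    · rw [Category.assoc, Category.id_comp]
      refine (congrArg (_ ≫ ·) (WidePullback.lift_base _ _ _ _)).trans ?_
      rw [pullback.lift_fst_assoc, WidePullback.lift_base]
  inv_hom_id := by
    apply pullback.hom_ext
    · rw [Category.assoc, pullback.lift_fst, Category.id_comp]
      apply WidePullback.hom_ext
      · intro i
        rw [Category.assoc, WidePullback.lift_π, WidePullback.lift_π]
        rfl
      · rw [Category.assoc, WidePullback.lift_base, WidePullback.lift_base]
    · rw [Category.assoc, pullback.lift_snd, Category.id_comp, WidePullback.lift_π]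
      rfl

theorem flat_fiberPowerBase [Flat π] (n : ℕ) : Flat (fiberPowerBase π n) := by
  induction n with
  | zero =>
    have := isIso_fiberPowerBase_zero π
    infer_instance
  | succ n ih =>
    have h : fiberPowerBase π (n + 1) =
        (fiberPowerSuccIso π n).hom ≫ pullback.fst _ _ ≫ fiberPowerBase π n := by
      rw [fiberPowerSuccIso, pullback.lift_fst_assoc, WidePullback.lift_base]
    rw [h]
    infer_instance

/-- Over the open set where `π` is finite étale, the fibre power is flat, so that every point
specializes from a point of the generic fibre. -/
theorem exists_specializes_of_mem_etaleLocus [IrreducibleSpace Z] (n : ℕ) {w : fiberPower π n}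
    (hw : fiberPowerBase π n w ∈ etaleLocus π) :
    ∃ w', w' ⤳ w ∧ fiberPowerBase π n w' = genericPoint Z := by
  obtain ⟨V : Z.Opens, ⟨-, hV⟩, hwV⟩ := TopologicalSpace.Opens.mem_sSup.mp hw
  have hflat := flat_fiberPowerBase (π ∣_ V) n
  let j : fiberPower (π ∣_ V) n ⟶ fiberPower π n :=
    WidePullback.lift (fiberPowerBase _ n ≫ V.ι) (fun i ↦ fiberPowerProj _ n i ≫ (π ⁻¹ᵁ V).ι)
      (fun i ↦ by rw [Category.assoc, ← morphismRestrict_ι, ← Category.assoc]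
                  rw [WidePullback.π_arrow])
  have hjbase : j ≫ fiberPowerBase π n = fiberPowerBase _ n ≫ V.ι := WidePullback.lift_base _ _ _ _
  -- The point `w` lifts along `j` because all its coordinates lie over `V`.
  obtain ⟨v, hv⟩ : ∃ v, j v = w := by
    let f := (fiberPower π n).fromSpecResidueField w
    have hbase : Set.range (f ≫ fiberPowerBase π n) ⊆ Set.range V.ι := by
      rintro _ ⟨x, rfl⟩
      rw [Scheme.Opens.range_ι, Scheme.Hom.comp_apply, Scheme.fromSpecResidueField_apply]
      exact hwV
    have hproj : ∀ i, Set.range (f ≫ fiberPowerProj π n i) ⊆ Set.range (π ⁻¹ᵁ V).ι := by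
      rintro i _ ⟨x, rfl⟩
      rw [Scheme.Opens.range_ι]
      change π _ ∈ V
      rw [← Scheme.Hom.comp_apply, Category.assoc, WidePullback.π_arrow, Scheme.Hom.comp_apply,
        Scheme.fromSpecResidueField_apply]
      exact hwV
    let f' : Spec ((fiberPower π n).residueField w) ⟶ fiberPower (π ∣_ V) n :=
      WidePullback.lift (IsOpenImmersion.lift V.ι _ hbase)
        (fun i ↦ IsOpenImmersion.lift (π ⁻¹ᵁ V).ι _ (hproj i)) (fun i ↦ by
          rw [← cancel_mono V.ι, Category.assoc, morphismRestrict_ι,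
            IsOpenImmersion.lift_fac_assoc, IsOpenImmersion.lift_fac, Category.assoc,
            WidePullback.π_arrow])
    have hf' : f' ≫ j = f := by
      apply WidePullback.hom_ext
      · intro i
        rw [Category.assoc, WidePullback.lift_π, WidePullback.lift_π_assoc,
          IsOpenImmersion.lift_fac]
      · rw [Category.assoc, hjbase, WidePullback.lift_base_assoc, IsOpenImmersion.lift_fac]
    exact ⟨f' (specPoint ((fiberPower π n).residueField w)),
      (congrArg (fun φ ↦ φ (specPoint ((fiberPower π n).residueField w))) hf').trans
        (fromSpecResidueField_specPoint w)⟩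
  have hη : genericPoint Z ∈ V :=
    (genericPoint_specializes (fiberPowerBase π n w)).mem_open V.isOpen hwV
  have hsp : (⟨genericPoint Z, hη⟩ : V) ⤳ fiberPowerBase (π ∣_ V) n v :=
    Topology.IsInducing.subtypeVal.specializes_iff.mp (genericPoint_specializes _)
  obtain ⟨v', hv', hv'η⟩ := Flat.generalizingMap (fiberPowerBase (π ∣_ V) n) hsp
  refine ⟨j v', hv ▸ hv'.map j.continuous, ?_⟩
  rw [← Scheme.Hom.comp_apply, hjbase, Scheme.Hom.comp_apply, hv'η]
  rfl

/-- Two morphisms over `Z` to a separated `Z`-scheme agree on a closed subset. -/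
theorem isClosed_range_equalizer_ι [IsSeparated π] {Y : Scheme.{u}} {p q : Y ⟶ X}
    (h : p ≫ π = q ≫ π) : IsClosed (Set.range (equalizer.ι p q)) := by
  -- The equalizer is the preimage of the diagonal of `X` over `Z`.
  have hrange : Set.range (equalizer.ι p q) =
      pullback.lift p q h ⁻¹' Set.range (pullback.diagonal π) := by
    apply Set.Subset.antisymm
    · rintro _ ⟨x, rfl⟩
      refine ⟨(equalizer.ι p q ≫ p) x, ?_⟩
      have hd : (equalizer.ι p q ≫ p) ≫ pullback.diagonal π =
          equalizer.ι p q ≫ pullback.lift p q h := by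
        apply pullback.hom_ext
        · rw [Category.assoc, pullback.diagonal_fst, Category.comp_id, Category.assoc,
            pullback.lift_fst]
        · rw [Category.assoc, pullback.diagonal_snd, Category.comp_id, Category.assoc,
            pullback.lift_snd, equalizer.condition]
      exact congrArg (fun φ ↦ φ x) hd
    · rintro y ⟨x, hx⟩
      obtain ⟨t, ht, -⟩ := Scheme.Pullback.exists_preimage_pullback
        (f := pullback.lift p q h) (g := pullback.diagonal π) y x hx.symm
      have hc : pullback.fst (pullback.lift p q h) (pullback.diagonal π) ≫ p =
          pullback.fst (pullback.lift p q h) (pullback.diagonal π) ≫ q := by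
        have h1 := congrArg (· ≫ pullback.fst π π)
          (pullback.condition (f := pullback.lift p q h) (g := pullback.diagonal π))
        have h2 := congrArg (· ≫ pullback.snd π π)
          (pullback.condition (f := pullback.lift p q h) (g := pullback.diagonal π))
        simp only [Category.assoc, pullback.lift_fst, pullback.lift_snd, pullback.diagonal_fst,
          pullback.diagonal_snd] at h1 h2
        rw [h1, h2]
      refine ⟨equalizer.lift _ hc t, ?_⟩
      rw [← Scheme.Hom.comp_apply, equalizer.lift_ι, ht]
  rw [hrange]
  exact (pullback.diagonal π).isClosedEmbedding.isClosed_range.preimage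
    (pullback.lift p q h).continuous

theorem isClosed_bigDiagonal [IsSeparated π] (n : ℕ) : IsClosed (bigDiagonal π n) := by
  refine isClosed_iUnion_of_finite fun i ↦ isClosed_iUnion_of_finite fun j ↦
    isClosed_iUnion_of_finite fun _ ↦ isClosed_range_equalizer_ι π ?_
  rw [WidePullback.π_arrow, WidePullback.π_arrow]

end Generization

/-! ### Spreading out finite étale algebras -/

section SpreadingOut

variable {A B : Type*} [CommRing A] [CommRing B] [Algebra A B]

theorem isIntegral_of_isUnit_mul {R S : Type*} [CommRing R] [CommRing S] [Algebra R S] {r : R}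
    (hr : IsUnit r) {x : S} (h : _root_.IsIntegral R (algebraMap R S r * x)) :
    _root_.IsIntegral R x := by
  obtain ⟨u, rfl⟩ := hr
  have h1 := h.smul (↑u⁻¹ : R)
  rwa [← Algebra.smul_def, smul_smul, Units.inv_mul, one_smul] at h1

/-- An algebraic algebra of finite type over a domain becomes finite after inverting a suitable
nonzero element: one that turns each generator into an integral element. -/
theorem exists_forall_finite_away [IsDomain A] [Algebra.FiniteType A B] [Algebra.IsAlgebraic A B] :
    ∃ a : A, a ≠ 0 ∧ ∀ a' : A, a ∣ a' →
      ∀ (R S : Type u) [CommRing R] [CommRing S] [Algebra A R] [Algebra B S] [Algebra R S]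
        [Algebra A S] [IsScalarTower A R S] [IsScalarTower A B S] [IsLocalization.Away a' R]
        [IsLocalization.Away (algebraMap A B a') S], Module.Finite R S := by
  classical
  obtain ⟨s, hs⟩ := Algebra.FiniteType.out (R := A) (A := B)
  obtain ⟨a, ha, hint⟩ := Algebra.IsAlgebraic.exists_integral_multiples A s
  refine ⟨a, ha, fun a' haa' R S => ?_⟩
  intros
  have hB : ∀ b : B, _root_.IsIntegral R (algebraMap B S b) := by
    intro b
    have hb : b ∈ Algebra.adjoin A (s : Set B) := hs ▸ Algebra.mem_top
    induction hb using Algebra.adjoin_induction with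
    | mem x hx =>
      have h1 : _root_.IsIntegral A (algebraMap B S (a • x)) :=
        (hint x hx).map (IsScalarTower.toAlgHom A B S)
      have hu : IsUnit (algebraMap A R a) :=
        isUnit_of_dvd_unit (map_dvd _ haa') (IsLocalization.Away.algebraMap_isUnit a')
      refine isIntegral_of_isUnit_mul hu ?_
      rw [← IsScalarTower.algebraMap_apply, IsScalarTower.algebraMap_apply A B S, ← map_mul,
        ← Algebra.smul_def]
      exact h1.tower_top
    | algebraMap r =>
      rw [← IsScalarTower.algebraMap_apply, IsScalarTower.algebraMap_apply A R S]
      exact isIntegral_algebraMap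
    | add x y _ _ hx hy => rw [map_add]; exact hx.add hy
    | mul x y _ _ hx hy => rw [map_mul]; exact hx.mul hy
  have hS : Algebra.IsIntegral R S := by
    constructor
    intro x
    obtain ⟨n, b, hb⟩ := IsLocalization.Away.surj (algebraMap A B a') x
    have hu : IsUnit (algebraMap A R (a' ^ n)) := by
      rw [map_pow]; exact (IsLocalization.Away.algebraMap_isUnit a').pow n
    refine isIntegral_of_isUnit_mul hu ?_
    rw [← IsScalarTower.algebraMap_apply, IsScalarTower.algebraMap_apply A B S, map_pow, map_pow,
      mul_comm, hb]
    exact hB b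
  have : Algebra.FinitePresentation B S :=
    IsLocalization.Away.finitePresentation (algebraMap A B a')
  have : Algebra.FiniteType A S := .trans (S := B) inferInstance inferInstance
  have : Algebra.FiniteType R S := .of_restrictScalars_finiteType A R S
  exact Algebra.IsIntegral.finite

/-- An algebra of finite type over a Noetherian domain is étale after inverting a suitable nonzero
element, if the extension of fraction fields is separable algebraic. -/
theorem exists_forall_etale_away [IsDomain B] [IsNoetherianRing A] [Algebra.FiniteType A B]
    [Algebra.IsAlgebraic A B]
    (K L : Type*) [Field K] [Field L] [Algebra A K] [Algebra B L] [Algebra K L] [Algebra A L]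
    [IsScalarTower A K L] [IsScalarTower A B L] [IsFractionRing A K] [IsFractionRing B L]
    [Algebra.IsSeparable K L] :
    ∃ a : A, a ≠ 0 ∧ ∀ a' : A, a ∣ a' →
      ∀ (R S : Type u) [CommRing R] [CommRing S] [Algebra A R] [Algebra B S] [Algebra R S]
        [Algebra A S] [IsScalarTower A R S] [IsScalarTower A B S] [IsLocalization.Away a' R]
        [IsLocalization.Away (algebraMap A B a') S], Algebra.Etale R S := by
  have : Algebra.FinitePresentation A B := Algebra.FinitePresentation.of_finiteType.mp ‹_›
  -- The étale locus of `B` over `A` contains the generic point, whose local ring is `L`, hence a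
  -- basic open set `D(b)`, hence `D(a)` for a nonzero `a` in `A` that `b` divides.
  have hbot : (⟨⊥, Ideal.isPrime_bot⟩ : PrimeSpectrum B) ∈ Algebra.etaleLocus A B := by
    rw [Algebra.mem_etaleLocus_iff]
    have : Algebra.FormallyEtale K L := .of_isSeparable K L
    have : Algebra.FormallyEtale A K := .of_isLocalization (nonZeroDivisors A)
    have : Algebra.FormallyEtale A L := .comp A K L
    have : IsLocalization (⊥ : Ideal B).primeCompl L := by
      have h : (⊥ : Ideal B).primeCompl = nonZeroDivisors B := by
        ext x; simp [Ideal.primeCompl]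
      rw [h]; infer_instance
    exact .of_equiv ((IsLocalization.algEquiv (⊥ : Ideal B).primeCompl L
      (Localization.AtPrime (⊥ : Ideal B))).restrictScalars A)
  obtain ⟨_, ⟨_, ⟨b, rfl⟩, rfl⟩, hb, hle⟩ :=
    PrimeSpectrum.isBasis_basic_opens.exists_subset_of_mem_open hbot Algebra.isOpen_etaleLocus
  have hb0 : b ≠ 0 := hb
  obtain ⟨a, ha, hdvd⟩ := (Algebra.IsAlgebraic.isAlgebraic (R := A) b).exists_nonzero_dvd
    (mem_nonZeroDivisors_of_ne_zero hb0)
  refine ⟨a, ha, fun a' haa' R S => ?_⟩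
  intros
  have h1 : (PrimeSpectrum.basicOpen (algebraMap A B a') : Set (PrimeSpectrum B)) ⊆
      Algebra.etaleLocus A B :=
    Set.Subset.trans
      (show PrimeSpectrum.basicOpen (algebraMap A B a') ≤ PrimeSpectrum.basicOpen b from
      (PrimeSpectrum.basicOpen_le_basicOpen_iff _ _).mpr (Ideal.le_radical
        (Ideal.mem_span_singleton.mpr (hdvd.trans (map_dvd _ haa'))))) hle
  rw [Algebra.basicOpen_subset_etaleLocus_iff] at h1
  have : Algebra.FormallyEtale A S :=
    .of_equiv ((IsLocalization.algEquiv (.powers (algebraMap A B a'))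
      (Localization.Away (algebraMap A B a')) S).restrictScalars A)
  have : Algebra.FormallyEtale R S := .localization_base (.powers a')
  have : IsNoetherianRing R := IsLocalization.isNoetherianRing (.powers a') R ‹_›
  have : Algebra.FinitePresentation B S :=
    IsLocalization.Away.finitePresentation (algebraMap A B a')
  have : Algebra.FiniteType A S := .trans (S := B) inferInstance inferInstance
  have : Algebra.FiniteType R S := .of_restrictScalars_finiteType A R S
  exact ⟨‹_›, Algebra.FinitePresentation.of_finiteType.mp ‹_›⟩

end SpreadingOut

/-! ### A separable map is finite étale over the generic point -/

section GenericallyFiniteEtale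

variable {X Z : Scheme.{u}} [IsIntegral X] [IsIntegral Z]

/-- Compatibility of `functionFieldMap` with restriction to open subsets. -/
theorem germToFunctionField_comp_appLE (π : X ⟶ Z) [IsDominant π] (V : Z.Opens) (W : X.Opens)
    [Nonempty V] [Nonempty W] (h : W ≤ π ⁻¹ᵁ V) :
    (X.germToFunctionField W).hom.comp (π.appLE V W h).hom =
      (functionFieldMap π).comp (Z.germToFunctionField V).hom := by
  have hξ : genericPoint X ∈ W := ((genericPoint_spec X).mem_open_set_iff W.isOpen).mpr
    (by simpa using ‹Nonempty W›)
  have hη : genericPoint Z ∈ V := ((genericPoint_spec Z).mem_open_set_iff V.isOpen).mpr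
    (by simpa using ‹Nonempty V›)
  have hη' : π (genericPoint X) ∈ V := by rwa [map_genericPoint]
  have h1 : π.appLE V W h ≫ X.germToFunctionField W =
      π.app V ≫ X.presheaf.germ (π ⁻¹ᵁ V) (genericPoint X) hη' := by
    rw [Scheme.Hom.appLE, Category.assoc]
    exact congrArg (π.app V ≫ ·) (X.presheaf.germ_res (homOfLE h) _ hξ)
  have h2 : Z.germToFunctionField V ≫ Z.presheaf.stalkSpecializes
      (specializes_of_eq (map_genericPoint π)) ≫ π.stalkMap (genericPoint X) =
      π.app V ≫ X.presheaf.germ (π ⁻¹ᵁ V) (genericPoint X) hη' :=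
    (congrArg (· ≫ π.stalkMap _) (Z.presheaf.germ_stalkSpecializes hη
      (specializes_of_eq (map_genericPoint π)))).trans (π.germ_stalkMap V (genericPoint X) hη')
  rw [functionFieldMap, ← CommRingCat.hom_comp, ← CommRingCat.hom_comp, h1, h2]

/-- If the source `Y` of a separated morphism is irreducible, a nonempty open subscheme of `Y` that
is finite over the target is all of `Y`: it is both open and closed. -/
theorem isFinite_etale_of_comp {U Y V : Scheme.{u}} [IrreducibleSpace Y] [Nonempty U]
    (i : U ⟶ Y) [IsOpenImmersion i] (f : Y ⟶ V) [IsSeparated f] [IsFinite (i ≫ f)]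
    [Etale (i ≫ f)] : IsFinite f ∧ Etale f := by
  have : IsFinite i := .of_comp i f
  have hclopen : IsClopen (Set.range i) :=
    ⟨i.isClosedMap.isClosed_range, i.isOpenEmbedding.isOpen_range⟩
  have hsurj : Surjective i :=
    ⟨Set.range_eq_univ.mp (hclopen.eq_univ (Set.range_nonempty i))⟩
  have : IsIso i := (isIso_iff_isOpenImmersion_and_surjective i).mpr ⟨inferInstance, hsurj⟩
  rw [← IsIso.inv_hom_id_assoc i f]
  exact ⟨inferInstance, inferInstance⟩

theorem isFinite_etale_resLE {X Z : Scheme.{u}} (π : X ⟶ Z) {V : Z.Opens} {W : X.Opens}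
    (hV : IsAffineOpen V) (hW : IsAffineOpen W) (h : W ≤ π ⁻¹ᵁ V)
    (hfin : (π.appLE V W h).hom.Finite) (het : (π.appLE V W h).hom.Etale) :
    IsFinite (π.resLE V W h) ∧ Etale (π.resLE V W h) := by
  have : IsAffine V := hV
  have : IsAffine W := hW
  have happ : (π.resLE V W h).appTop = V.topIso.hom ≫ π.appLE V W h ≫ W.topIso.inv :=
    Scheme.Hom.resLE_app_top π h
  constructor
  · have : IsFinite (Spec.map (π.resLE V W h).appTop) := by
      rw [IsFinite.SpecMap_iff, happ, CommRingCat.hom_comp,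
        RingHom.finite_respectsIso.cancel_left_isIso,
        CommRingCat.hom_comp, RingHom.finite_respectsIso.cancel_right_isIso]
      exact hfin
    rw [← Iso.hom_inv_id_assoc (Scheme.isoSpec W) (π.resLE V W h), ← Scheme.isoSpec_inv_naturality]
    infer_instance
  · rw [HasRingHomProperty.iff_of_isAffine (P := @Etale.{u}), happ, CommRingCat.hom_comp,
      RingHom.Etale.respectsIso.cancel_left_isIso, CommRingCat.hom_comp,
      RingHom.Etale.respectsIso.cancel_right_isIso]
    exact het

/-- If `k(X) / k(Z)` is separable algebraic, then `π` is finite étale over a neighbourhood of the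
generic point of `Z`. For an affine open `W` of `X` over an affine open `V` of `Z`, inverting a
suitable `a ≠ 0` on `V` makes `W` finite étale over `V`; since `π` is separated, the localization of
`W` is then the whole preimage of the localization of `V`. -/
theorem genericPoint_mem_etaleLocus (π : X ⟶ Z) [IsDominant π]
    [LocallyOfFiniteType π] [IsSeparated π] [IsLocallyNoetherian Z]
    [Algebra Z.functionField X.functionField]
    (hπ : algebraMap Z.functionField X.functionField = functionFieldMap π)
    [Algebra.IsSeparable Z.functionField X.functionField] :
    genericPoint Z ∈ etaleLocus π := by
  obtain ⟨_, ⟨V : Z.Opens, hV, rfl⟩, hηV, -⟩ :=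
    Z.isBasis_affineOpens.exists_subset_of_mem_open (Set.mem_univ (genericPoint Z)) isOpen_univ
  have hξV : genericPoint X ∈ π ⁻¹ᵁ V := by
    change π _ ∈ V
    rwa [map_genericPoint]
  obtain ⟨_, ⟨W : X.Opens, hW, rfl⟩, hξW, hWV⟩ :=
    X.isBasis_affineOpens.exists_subset_of_mem_open hξV (π ⁻¹ᵁ V).isOpen
  have : Nonempty V := ⟨⟨_, hηV⟩⟩
  have : Nonempty W := ⟨⟨_, hξW⟩⟩
  have := functionField_isFractionRing_of_isAffineOpen X W hW
  have := functionField_isFractionRing_of_isAffineOpen Z V hV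
  have : IsNoetherianRing Γ(Z, V) := IsLocallyNoetherian.component_noetherian ⟨V, hV⟩
  let : Algebra Γ(Z, V) Γ(X, W) := (π.appLE V W hWV).hom.toAlgebra
  let : Algebra Γ(Z, V) X.functionField :=
    ((functionFieldMap π).comp (Z.germToFunctionField V).hom).toAlgebra
  have : IsScalarTower Γ(Z, V) Z.functionField X.functionField :=
    .of_algebraMap_eq' (by rw [hπ]; rfl)
  have : IsScalarTower Γ(Z, V) Γ(X, W) X.functionField :=
    .of_algebraMap_eq' (germToFunctionField_comp_appLE π V W hWV).symm
  have : Algebra.FiniteType Γ(Z, V) Γ(X, W) := π.finiteType_appLE hV hW hWV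
  have : Algebra.IsAlgebraic Γ(Z, V) X.functionField :=
    (IsFractionRing.comap_isAlgebraic_iff (K := Z.functionField)).mpr inferInstance
  have : Algebra.IsAlgebraic Γ(Z, V) Γ(X, W) :=
    .tower_bot_of_injective (IsFractionRing.injective Γ(X, W) X.functionField)
  obtain ⟨a₁, ha₁, hfin⟩ := exists_forall_finite_away.{u} (A := Γ(Z, V)) (B := Γ(X, W))
  obtain ⟨a₂, ha₂, het⟩ := exists_forall_etale_away.{u} (A := Γ(Z, V)) (B := Γ(X, W))
    Z.functionField X.functionField
  let a := a₁ * a₂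
  have ha : a ≠ 0 := mul_ne_zero ha₁ ha₂
  let b := π.appLE V W hWV a
  have hle : X.basicOpen b ≤ π ⁻¹ᵁ Z.basicOpen a := by
    simp [b, Scheme.Hom.appLE]
  let : Algebra Γ(Z, Z.basicOpen a) Γ(X, X.basicOpen b) :=
    (π.appLE (Z.basicOpen a) (X.basicOpen b) hle).hom.toAlgebra
  let : Algebra Γ(Z, V) Γ(X, X.basicOpen b) :=
    (π.appLE V (X.basicOpen b) ((X.basicOpen_le b).trans hWV)).hom.toAlgebra
  have : IsScalarTower Γ(Z, V) Γ(Z, Z.basicOpen a) Γ(X, X.basicOpen b) :=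
    .of_algebraMap_eq' (congrArg CommRingCat.Hom.hom
      (π.map_appLE hle (homOfLE (Z.basicOpen_le a)).op)).symm
  have : IsScalarTower Γ(Z, V) Γ(X, W) Γ(X, X.basicOpen b) :=
    .of_algebraMap_eq' (congrArg CommRingCat.Hom.hom
      (π.appLE_map hWV (homOfLE (X.basicOpen_le b)).op)).symm
  have : IsLocalization.Away a Γ(Z, Z.basicOpen a) := hV.isLocalization_basicOpen a
  have : IsLocalization.Away (algebraMap Γ(Z, V) Γ(X, W) a) Γ(X, X.basicOpen b) :=
    hW.isLocalization_basicOpen b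
  have hfin' := hfin a (dvd_mul_right _ _) Γ(Z, Z.basicOpen a) Γ(X, X.basicOpen b)
  have het' := het a (dvd_mul_left _ _) Γ(Z, Z.basicOpen a) Γ(X, X.basicOpen b)
  obtain ⟨h1, h2⟩ := isFinite_etale_resLE π (hV.basicOpen a) (hW.basicOpen b) hle hfin' het'
  have ha' : algebraMap Γ(Z, V) Z.functionField a ≠ 0 := fun h =>
    ha (IsFractionRing.injective Γ(Z, V) Z.functionField (by rw [h, map_zero]))
  have hηa : genericPoint Z ∈ Z.basicOpen a :=
    (Z.mem_basicOpen a _ hηV).mpr (isUnit_iff_ne_zero.mpr ha')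
  have hξb : genericPoint X ∈ X.basicOpen b := by
    refine (X.mem_basicOpen b _ hξW).mpr (isUnit_iff_ne_zero.mpr fun h => ha' ?_)
    refine (algebraMap Z.functionField X.functionField).injective ?_
    rw [map_zero, ← IsScalarTower.algebraMap_apply Γ(Z, V),
      IsScalarTower.algebraMap_apply Γ(Z, V) Γ(X, W)]
    exact h
  have : Nonempty (X.basicOpen b) := ⟨⟨_, hξb⟩⟩
  have : IrreducibleSpace (π ⁻¹ᵁ Z.basicOpen a) :=
    have : Nonempty (π ⁻¹ᵁ Z.basicOpen a) := ⟨⟨_, hle hξb⟩⟩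
    inferInstance
  have hcomp : X.homOfLE hle ≫ (π ∣_ Z.basicOpen a) =
      π.resLE (Z.basicOpen a) (X.basicOpen b) hle := by
    rw [← Scheme.Hom.resLE_eq_morphismRestrict, Scheme.Hom.map_resLE]
  rw [← hcomp] at h1 h2
  exact TopologicalSpace.Opens.mem_sSup.mpr ⟨Z.basicOpen a,
    isFinite_etale_of_comp (X.homOfLE hle) (π ∣_ Z.basicOpen a), hηa⟩

end GenericallyFiniteEtale

/-! ### Irreducible components with finitely many generic points -/

section Topology

variable {Y : Type*} [TopologicalSpace Y]

theorem exists_subset_closure_singleton {ι : Type*} [Finite ι] {W : Set Y} {p : ι → Y}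
    (hW : ∀ w ∈ W, ∃ i, p i ⤳ w) {T : Set Y} (hT : IsIrreducible T) (hTW : T ⊆ closure W) :
    ∃ i, T ⊆ closure {p i} := by
  have hcover : closure W ⊆ ⋃ i, closure {p i} := by
    refine closure_minimal (fun w hw => ?_) (isClosed_iUnion_of_finite fun _ => isClosed_closure)
    obtain ⟨i, hi⟩ := hW w hw
    exact Set.mem_iUnion.mpr ⟨i, hi.mem_closure⟩
  have hfin := Set.finite_range fun i => closure {p i}
  obtain ⟨z, hz, hTz⟩ := isIrreducible_iff_sUnion_isClosed.mp hT hfin.toFinset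
    (by simp) (by simpa using hTW.trans hcover)
  obtain ⟨i, rfl⟩ := hfin.mem_toFinset.mp hz
  exact ⟨i, hTz⟩

/-- If every point of `W` specializes from one of finitely many points of `W`, then the maximal
irreducible subsets of `closure W` are closures of these points. -/
theorem exists_eq_closure_singleton_of_maximal {ι : Type*} [Finite ι] {W : Set Y} {p : ι → Y}
    (hp : ∀ i, p i ∈ W) (hW : ∀ w ∈ W, ∃ i, p i ⤳ w) {T : Set Y}
    (hT : Maximal (fun T : Set Y => IsIrreducible T ∧ T ⊆ closure W) T) :
    ∃ i, T = closure {p i} := by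
  obtain ⟨i, hi⟩ := exists_subset_closure_singleton hW hT.prop.1 hT.prop.2
  exact ⟨i, hT.eq_of_subset ⟨isIrreducible_singleton.closure,
    closure_mono (Set.singleton_subset_iff.mpr (hp i))⟩ hi⟩

theorem exists_maximal_isIrreducible {ι : Type*} [Finite ι] [Nonempty ι] {W : Set Y} {p : ι → Y}
    (hp : ∀ i, p i ∈ W) (hW : ∀ w ∈ W, ∃ i, p i ⤳ w) :
    ∃ T, Maximal (fun T : Set Y => IsIrreducible T ∧ T ⊆ closure W) T := by
  obtain ⟨_, ⟨i, rfl⟩, hi⟩ := (Set.finite_range fun i => closure {p i}).exists_maximal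
    (Set.range_nonempty _)
  refine ⟨closure {p i}, ⟨isIrreducible_singleton.closure,
    closure_mono (Set.singleton_subset_iff.mpr (hp i))⟩, fun T hT hiT => ?_⟩
  obtain ⟨j, hj⟩ := exists_subset_closure_singleton hW hT.1 hT.2
  exact hj.trans (hi ⟨j, rfl⟩ (hiT.trans hj))

end Topology

/-! ### Comparison of the two groups -/

section MonodromyGroup

variable {X Z : Scheme.{u}} (π : X ⟶ Z) (n : ℕ)

theorem mem_monodromyGroup_closure_singleton_iff (x : fiberPower π n)
    (σ : Equiv.Perm (Fin n)) :
    σ ∈ monodromyGroup π n (closure {x}) ↔ permMap π n σ x = x := by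
  have h1 : permMap π n σ ≫ permMap π n σ⁻¹ = 𝟙 _ := by
    rw [← permMap_mul, inv_mul_cancel, permMap_one]
  have h2 : permMap π n σ⁻¹ ≫ permMap π n σ = 𝟙 _ := by
    rw [← permMap_mul, mul_inv_cancel, permMap_one]
  have : IsIso (permMap π n σ) := ⟨_, h1, h2⟩
  have h : permMap π n σ '' closure {x} = closure {permMap π n σ x} :=
    ((permMap π n σ).homeomorph.image_closure {x}).trans (congrArg closure Set.image_singleton)
  change permMap π n σ '' closure {x} = closure {x} ↔ _
  rw [h, ← inseparable_iff_closure_eq, inseparable_iff_eq]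

end MonodromyGroup

section GaloisAction

variable {F : Type u} {E : Type v} [Field F] [Field E] [Algebra F E] {n : ℕ}

theorem mem_range_galoisPerm_iff (e : Labelling F E n) (σ : Equiv.Perm (Fin n)) :
    σ ∈ (galoisPerm e).range ↔ ∃ g : NormClosure F E ≃ₐ[F] NormClosure F E,
      ∀ i, (g : NormClosure F E →ₐ[F] NormClosure F E).comp (e (σ⁻¹ i)) = e i := by
  refine exists_congr fun g => ⟨?_, fun h => ?_⟩
  · rintro rfl i
    ext1 x
    rw [AlgHom.comp_apply]
    refine (labelling_galoisPerm_apply e g _ x).symm.trans ?_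
    rw [Equiv.Perm.inv_def, Equiv.apply_symm_apply]
  · ext1 i
    apply e.injective
    ext1 x
    rw [labelling_galoisPerm_apply, ← h (σ i), Equiv.Perm.inv_def, Equiv.symm_apply_apply]
    rfl

/-- Two labellings give conjugate permutation representations. -/
theorem galoisPerm_range_eq_map_conj (e e' : Labelling F E n) :
    (galoisPerm e').range =
      (galoisPerm e).range.map
        (MulAut.conj (e.trans e'.symm : Equiv.Perm (Fin n))).toMonoidHom := by
  have : galoisPerm e' =
      (MulAut.conj (e.trans e'.symm : Equiv.Perm (Fin n))).toMonoidHom.comp (galoisPerm e) := by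
    ext1 g
    rw [MonoidHom.comp_apply]
    ext1 i
    simp [galoisPerm]
  rw [this, MonoidHom.range_comp]

end GaloisAction

section Components

variable {X Z : Scheme.{u}} [IsIntegral X] [IsIntegral Z] (π : X ⟶ Z) [IsDominant π]
  [Algebra Z.functionField X.functionField]
  (hπ : algebraMap Z.functionField X.functionField = functionFieldMap π) {n : ℕ}

theorem tuplePoint_mem_etale_sdiff_bigDiagonal [LocallyOfFiniteType π]
    [IsSeparated π] [IsLocallyNoetherian Z]
    [Algebra.IsSeparable Z.functionField X.functionField]
    (e : Labelling Z.functionField X.functionField n) :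
    tuplePoint hπ e ∈ fiberPowerBase π n ⁻¹' (etaleLocus π : Set Z) \ bigDiagonal π n := by
  refine ⟨?_, fun h => (tuplePoint_mem_bigDiagonal_iff hπ e).mp h e.injective⟩
  rw [Set.mem_preimage, fiberPowerBase_tuplePoint]
  exact genericPoint_mem_etaleLocus π hπ

/-- The point of the generic fibre from which `w` specializes is off the big diagonal, because the
big diagonal is closed. -/
theorem exists_tuplePoint_specializes [IsSeparated π]
    [FiniteDimensional Z.functionField X.functionField]
    (e₀ : Labelling Z.functionField X.functionField n)
    {w : fiberPower π n}
    (hw : w ∈ fiberPowerBase π n ⁻¹' (etaleLocus π : Set Z) \ bigDiagonal π n) :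
    ∃ e : Labelling Z.functionField X.functionField n, tuplePoint hπ e ⤳ w := by
  obtain ⟨w', hw', hbase⟩ := exists_specializes_of_mem_etaleLocus π n hw.1
  have hwd : w' ∉ bigDiagonal π n := fun h =>
    hw.2 (hw'.mem_closed (isClosed_bigDiagonal π n) h)
  obtain ⟨e, rfl⟩ := exists_labelling_tuplePoint_eq hπ e₀ hbase hwd
  exact ⟨e, hw'⟩

/-- The component through `tuplePoint e` is preserved by `σ` if and only if `σ` comes from the
Galois group. -/
theorem monodromyGroup_closure_tuplePoint
    [Algebra.IsAlgebraic Z.functionField X.functionField]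
    (e : Labelling Z.functionField X.functionField n) :
    monodromyGroup π n (closure {tuplePoint hπ e}) = (galoisPerm e).range := by
  ext σ
  rw [mem_monodromyGroup_closure_singleton_iff, permMap_tuplePoint, mem_range_galoisPerm_iff]
  exact tuplePoint_eq_iff hπ (σ⁻¹.trans e : Labelling Z.functionField X.functionField n) e

end Components

end BranchedCover

theorem theorem1p1 {k : Type u} [Field k] {X Z : Scheme.{u}}
    (sX : X ⟶ Spec (CommRingCat.of k)) (sZ : Z ⟶ Spec (CommRingCat.of k))
    [IsIntegral X] [IsSeparated sX] [LocallyOfFiniteType sX] [QuasiCompact sX]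
    [IsIntegral Z] [IsSeparated sZ] [LocallyOfFiniteType sZ] [QuasiCompact sZ]
    (π : X ⟶ Z) (hπ : π ≫ sZ = sX) [IsDominant π]
    (hdim : dimension sX = dimension sZ) (hsep : IsSeparableMap π) :
    letI := functionFieldAlgebra π
    Nonempty (Labelling Z.functionField X.functionField (degree π)) ∧
    (∃ X' : Set (fiberPower π (degree π)), IsComponent π (degree π) X') ∧
    ∀ e : Labelling Z.functionField X.functionField (degree π),
      Function.Injective (galoisPerm e) ∧
      ∀ X' : Set (fiberPower π (degree π)), IsComponent π (degree π) X' →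
        ∃ τ : Equiv.Perm (Fin (degree π)),
          monodromyGroup π (degree π) X' =
            (galoisPerm e).range.map (MulAut.conj τ).toMonoidHom := by
  let := functionFieldAlgebra π
  have hmap : algebraMap Z.functionField X.functionField = functionFieldMap π := rfl
  have : FiniteDimensional Z.functionField X.functionField :=
    finite_functionField sX sZ π hπ hdim
  have : Algebra.IsSeparable Z.functionField X.functionField :=
    IsSeparablyGenerated.isSeparable hsep
  have : LocallyOfFiniteType (π ≫ sZ) := hπ ▸ inferInstance
  have : LocallyOfFiniteType π := locallyOfFiniteType_of_comp π sZ
  have : IsSeparated (π ≫ sZ) := hπ ▸ inferInstance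
  have : IsSeparated π := .of_comp π sZ
  have : IsLocallyNoetherian Z := LocallyOfFiniteType.isLocallyNoetherian sZ
  obtain ⟨e₀⟩ : Nonempty (Labelling Z.functionField X.functionField (degree π)) :=
    nonempty_labelling
  have : Nonempty (Labelling Z.functionField X.functionField (degree π)) := ⟨e₀⟩
  have hmem := tuplePoint_mem_etale_sdiff_bigDiagonal (n := degree π) π hmap
  have hspec := fun w hw => exists_tuplePoint_specializes (w := w) π hmap e₀ hw
  refine ⟨⟨e₀⟩, exists_maximal_isIrreducible hmem hspec, fun e =>
    ⟨galoisPerm_injective e, fun T hT => ?_⟩⟩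
  obtain ⟨e', rfl⟩ := exists_eq_closure_singleton_of_maximal hmem hspec hT
  exact ⟨_, (monodromyGroup_closure_tuplePoint π hmap e').trans
    (galoisPerm_range_eq_map_conj e e')⟩

end
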